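/- Setting. Let $\mathbb A\neq\{0\}$ be a finite dimensional real alternative algebra with unity (so $\alpha(\alpha\beta)=(\alpha\alpha)\beta$ and $(\alpha\beta)\beta=\alpha(\beta\beta)$; associativity is not assumed), with a real linear anti-involution $\alpha\mapsto\alpha^c$ (so $(\alpha^c)^c=\alpha$, $(\alpha\beta)^c=\beta^c\alpha^c$, $r^c=r$ for $r\in\mathbb R$), where $\mathbb R$ is identified with $\mathbb R\cdot 1\subseteq\mathbb A$. Let $Q_{\mathbb A}:=\mathbb R\cup\{\alpha\in\mathbb A : t(\alpha):=\alpha+\alpha^c\in\mathbb R,\ n(\alpha):=\alpha\alpha^c\in\mathbb R,\ t(\alpha)^2-4n(\alpha)<0\}$. Assume that some $j\in Q_{\mathbb A}$ satisfies $j^2=-1$, and that $\mathbb A$ carries a norm $|\cdot|$ (as a real vector space) with $|\alpha|=\sqrt{n(\alpha)}$ for all $\alpha\in Q_{\mathbb A}$. Let $X$ be a Banach $\mathbb A$-bimodule: an abelian group with left and right multiplications $(\alpha,u)\mapsto\alpha u$ and $(u,\alpha)\mapsto u\alpha$ by elements of $\mathbb A$ that are biadditive and satisfy $1u=u1=u$,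 $r(su)=(rs)u$, $(ur)s=u(rs)$ and $ru=ur$ for $r,s\in\mathbb R$ (so that $X$ is a real vector space), and, if $\mathbb A$ is associative, also $\alpha(\beta u)=(\alpha\beta)u$, $(u\alpha)\beta=u(\alpha\beta)$ and $\alpha(u\beta)=(\alpha u)\beta$; with a complete norm such that $\|\alpha u\|\le|\alpha|\|u\|$ and $\|u\alpha\|\le|\alpha|\|u\|$ for all $\alpha\in\mathbb A$, $u \in X$, with equality in both if $\alpha\in Q_{\mathbb A}$. An operator $A:D(A)\to X$ is right linear if $D(A)\subseteq X$ is a right $\mathbb A$-submodule (a subgroup closed under right multiplication), $A$ is additive, and $A(u\alpha)=A(u)\alpha$. Let $\mathscr L^r(X)$ be the set of bounded right linear operators $X\to X$. For a right linear operator $A$, let $\rho_s(A)$ (the spherical resolvent set) be the set of all $\alpha\in Q_{\mathbb A}$ such that $\Delta_\alpha(A):=A^2-2\,\mathrm{Re}(\alpha)A+|\alpha|^2\,\mathrm{Id}:D(A^2)\to X$ is bijective with $\Delta_\alpha(A)^{-1}\in\mathscr L^r(X)$, where $\mathrm{Re}(\alpha)=(\alpha+\alpha^c)/2$ and $D(A^2)=\{x\in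 D(A):Ax\in D(A)\}$. A strongly continuous semigroup is a map $T:[0,\infty)\to\mathscr L^r(X)$ with $T(0)=\mathrm{Id}$, $T(t+s)=T(t)T(s)$ for $t,s\ge0$, and $t\mapsto T(t)x$ continuous on $[0,\infty)$ for every $x\in X$. Its generator is the operator whose domain is the set of all $x\in X$ for which $\lim_{h\to0^+}\frac1h(T(h)x-x)$ exists and whose value at such an $x$ is this limit. Theorem. Let $A:D(A)\to X$ be a closed right linear operator with $D(A)$ dense in $X$. The following conditions are equivalent: (a) $A$ is the generator of a strongly continuous semigroup $T:[0,\infty)\to\mathscr L^r(X)$. (b) $\rho_s(A)\cap\mathbb R\ne\emptyset$ and, for every $x\in D(A)$, there exists a unique $u\in C^1([0,\infty);X)$ such that $u(t)\in D(A)$ and $u'(t)=Au(t)$ for all $t\ge0$, and $u(0)=x$. In such cases (that is, whenever $T$ is a strongly continuous semigroup with generator $A$), for every $x\in D(A)$ the unique solution in (b) is $u(t)=T(t)x$, $t\ge0$. -/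

import Mathlib

open Set Filter Topology

/-- The quadratic cone of a real algebra with anti-involution `α ↦ star α`. The field `ℝ` is
identified with the set of the elements `r • 1`. -/
def quadraticCone (𝔸 : Type*) [NonAssocRing 𝔸] [Module ℝ 𝔸] [Star 𝔸] : Set 𝔸 :=
  {α | (∃ r : ℝ, α = r • (1 : 𝔸)) ∨
    ∃ t n : ℝ, α + star α = t • (1 : 𝔸) ∧ α * star α = n • (1 : 𝔸) ∧ t ^ 2 - 4 * n < 0}

/-- The square roots of `-1` in the quadratic cone. -/
def imaginaryUnits (𝔸 : Type*) [NonAssocRing 𝔸] [Module ℝ 𝔸] [Star 𝔸] : Set 𝔸 :=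
  {j | j ∈ quadraticCone 𝔸 ∧ j * j = -1}

/-- A nonzero finite dimensional real alternative algebra with unity and with an anti-involution
(the bilinearity of the product is expressed by the two scalar compatibility classes), which has
at least one imaginary unit, and which is endowed with a vector space norm (not assumed
submultiplicative) such that `|α| = √(α αᶜ)` on the quadratic cone. -/
class NormedAlternativeStarAlgebra (𝔸 : Type*) [NonAssocRing 𝔸] [Module ℝ 𝔸] [StarRing 𝔸]
    [Norm 𝔸] : Prop extends IsScalarTower ℝ 𝔸 𝔸, SMulCommClass ℝ 𝔸 𝔸, StarModule ℝ 𝔸,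
    Nontrivial 𝔸, FiniteDimensional ℝ 𝔸 where
  left_alternative : ∀ α β : 𝔸, α * (α * β) = (α * α) * β
  right_alternative : ∀ α β : 𝔸, (α * β) * β = α * (β * β)
  exists_imaginaryUnit : (imaginaryUnits 𝔸).Nonempty
  norm_eq_zero_iff : ∀ α : 𝔸, ‖α‖ = 0 ↔ α = 0
  norm_add_le' : ∀ α β : 𝔸, ‖α + β‖ ≤ ‖α‖ + ‖β‖
  norm_real_smul : ∀ (r : ℝ) (α : 𝔸), ‖r • α‖ = |r| * ‖α‖
  norm_eq_sqrt : ∀ α ∈ quadraticCone 𝔸, ∀ n : ℝ, α * star α = n • (1 : 𝔸) → ‖α‖ = √n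

/-- Normed bimodules over `𝔸`. The left multiplication `α u` is `α • u`, the right multiplication
`u α` is `MulOpposite.op α • u`. The real vector space structure of `X` is the one given by
restricting either of the two multiplications to `ℝ ⊆ 𝔸`. Associativity of the multiplications is
required only if `𝔸` is associative. -/
class NormedAlternativeBimodule (𝔸 X : Type*) [NonAssocRing 𝔸] [Module ℝ 𝔸] [StarRing 𝔸] [Norm 𝔸]
    [NormedAddCommGroup X] [NormedSpace ℝ X] [SMul 𝔸 X] [SMul 𝔸ᵐᵒᵖ X] : Prop where
  left_smul_add : ∀ (α : 𝔸) (u v : X), α • (u + v) = α • u + α • v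
  left_add_smul : ∀ (α β : 𝔸) (u : X), (α + β) • u = α • u + β • u
  left_real_smul : ∀ (r : ℝ) (u : X), (r • (1 : 𝔸)) • u = r • u
  right_smul_add : ∀ (α : 𝔸) (u v : X),
    MulOpposite.op α • (u + v) = MulOpposite.op α • u + MulOpposite.op α • v
  right_add_smul : ∀ (α β : 𝔸) (u : X),
    MulOpposite.op (α + β) • u = MulOpposite.op α • u + MulOpposite.op β • u
  right_real_smul : ∀ (r : ℝ) (u : X), MulOpposite.op (r • (1 : 𝔸)) • u = r • u
  left_assoc : (∀ a b c : 𝔸, (a * b) * c = a * (b * c)) →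
    ∀ (α β : 𝔸) (u : X), α • (β • u) = (α * β) • u
  right_assoc : (∀ a b c : 𝔸, (a * b) * c = a * (b * c)) →
    ∀ (α β : 𝔸) (u : X),
      MulOpposite.op β • (MulOpposite.op α • u) = MulOpposite.op (α * β) • u
  middle_assoc : (∀ a b c : 𝔸, (a * b) * c = a * (b * c)) →
    ∀ (α β : 𝔸) (u : X), α • (MulOpposite.op β • u) = MulOpposite.op β • (α • u)
  norm_left_smul_le : ∀ (α : 𝔸) (u : X), ‖α • u‖ ≤ ‖α‖ * ‖u‖
  norm_right_smul_le : ∀ (α : 𝔸) (u : X), ‖MulOpposite.op α • u‖ ≤ ‖α‖ * ‖u‖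
  norm_left_smul : ∀ α ∈ quadraticCone 𝔸, ∀ u : X, ‖α • u‖ = ‖α‖ * ‖u‖
  norm_right_smul : ∀ α ∈ quadraticCone 𝔸, ∀ u : X, ‖MulOpposite.op α • u‖ = ‖α‖ * ‖u‖

section

variable (𝔸 : Type*) {X : Type*} [NormedAddCommGroup X] [NormedSpace ℝ X]

/-- Right linearity of an operator `A : D(A) → X`: `D(A)` is a right `𝔸`-submodule and
`A (x α) = (A x) α`. (Additivity and the closure of `D(A)` under addition are part of
`X →ₗ.[ℝ] X`.) -/
def IsRightLinear [SMul 𝔸ᵐᵒᵖ X] (A : X →ₗ.[ℝ] X) : Prop :=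
  ∀ (α : 𝔸) (x : A.domain), ∃ h : MulOpposite.op α • (x : X) ∈ A.domain,
    A ⟨MulOpposite.op α • (x : X), h⟩ = MulOpposite.op α • A x

/-- The bounded right linear operators that are defined on all of `X`. -/
def boundedRightLinear (X : Type*) [NormedAddCommGroup X] [NormedSpace ℝ X] [SMul 𝔸ᵐᵒᵖ X] :
    Set (X →L[ℝ] X) :=
  {B | ∀ (α : 𝔸) (x : X), B (MulOpposite.op α • x) = MulOpposite.op α • B x}

/-- The domain of `A²`. -/
def sqDomain (A : X →ₗ.[ℝ] X) : Set X :=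
  {x | ∃ h : x ∈ A.domain, A ⟨x, h⟩ ∈ A.domain}

/-- The operator `Δ_α(A) = A² - 2 Re(α) A + |α|² Id : D(A²) → X`, where `Re(α) = (α + αᶜ) / 2`
acts on `X` as an element of `𝔸`. -/
noncomputable def sphericalDelta {𝔸 : Type*} [NonAssocRing 𝔸] [Module ℝ 𝔸] [Star 𝔸] [Norm 𝔸]
    [SMul 𝔸 X] (A : X →ₗ.[ℝ] X) (α : 𝔸) (x : sqDomain A) : X :=
  A ⟨A ⟨x, x.2.choose⟩, x.2.choose_spec⟩
    - ((2 : ℝ) • ((2 : ℝ)⁻¹ • (α + star α))) • A ⟨x, x.2.choose⟩ + ‖α‖ ^ 2 • (x : X)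

/-- The spherical resolvent set of `A`: the elements `α` of the quadratic cone for which `Δ_α(A)`
is bijective with inverse a bounded right linear operator. -/
def sphericalResolventSet [NonAssocRing 𝔸] [Module ℝ 𝔸] [Star 𝔸] [Norm 𝔸] [SMul 𝔸 X]
    [SMul 𝔸ᵐᵒᵖ X] (A : X →ₗ.[ℝ] X) : Set 𝔸 :=
  {α | α ∈ quadraticCone 𝔸 ∧ Function.Bijective (sphericalDelta A α) ∧
    ∃ Q ∈ boundedRightLinear 𝔸 X, ∀ x : sqDomain A, Q (sphericalDelta A α x) = x}

/-- Strongly continuous semigroups of right linear operators; only the values `T t` with `0 ≤ t`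
matter. -/
structure IsStronglyContinuousSemigroup [SMul 𝔸ᵐᵒᵖ X] (T : ℝ → X →L[ℝ] X) : Prop where
  right_linear : ∀ t, 0 ≤ t → T t ∈ boundedRightLinear 𝔸 X
  map_zero : T 0 = ContinuousLinearMap.id ℝ X
  map_add : ∀ t s, 0 ≤ t → 0 ≤ s → T (t + s) = (T t).comp (T s)
  strongly_continuous : ∀ x : X, ContinuousOn (fun t => T t x) (Ici 0)

/-- `A` is the generator of `T`: the domain of `A` consists of all `x` for which
`(1 / h) (T(h) x - x)` converges as `h → 0⁺`, and `A x` is the limit. -/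
structure IsGenerator (A : X →ₗ.[ℝ] X) (T : ℝ → X →L[ℝ] X) : Prop where
  mem_domain_iff : ∀ x : X, x ∈ A.domain ↔
    ∃ y : X, Tendsto (fun h : ℝ => h⁻¹ • (T h x - x)) (𝓝[>] 0) (𝓝 y)
  tendsto : ∀ x : A.domain,
    Tendsto (fun h : ℝ => h⁻¹ • (T h (x : X) - (x : X))) (𝓝[>] 0) (𝓝 (A x))

/-- `u ∈ C¹([0, ∞); X)` solves `u'(t) = A u(t)` for all `t ≥ 0`, `u(0) = x`; only the values
`u t` with `0 ≤ t` matter. -/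
structure IsC1Solution (A : X →ₗ.[ℝ] X) (x : X) (u : ℝ → X) : Prop where
  contDiffOn : ContDiffOn ℝ 1 u (Ici 0)
  mem_domain : ∀ t, 0 ≤ t → u t ∈ A.domain
  hasDerivWithinAt : ∀ (t : ℝ) (ht : 0 ≤ t),
    HasDerivWithinAt u (A ⟨u t, mem_domain t ht⟩) (Ici 0) t
  initial : u 0 = x

end

/-!
For a real number `r` the operator `Δ_r(A)` is `(A - r)²`, so `r` lies in the spherical resolvent
set exactly when `A - r` has a bounded everywhere defined inverse `R`
(`exists_isRealResolvent_of_mem`, `IsRealResolvent.mem_sphericalResolventSet`). The theorem thus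
reduces to one about a real Banach space, where right linearity is only the statement that bounded
operators `x ↦ x α` commute with `A`; all operators constructed below inherit this by uniqueness.

If `A` generates `T`, then orbits starting in the domain are `C¹` solutions, and for any solution
`u` the function `s ↦ T (t - s) (u s)` has right derivative zero on `[0, t)`, which gives
`u t = T t (u 0)`. A real resolvent comes from the integral over a single unit of time: with
`S t = exp (-l t) T t` and `K = ∫ s in 0..1, S s` one has `(A - l) K = S 1 - 1`, and this is
invertible for large `l`. No growth bound and no Laplace transform are needed
(`IsStronglyContinuousSemigroup.exists_isRealResolvent`).

Conversely, let the Cauchy problem be well posed and let `R = (A - r)⁻¹`. The solution map from the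
domain, with the graph norm, to `C([0, b])` has closed graph, hence is bounded
(`IsWellPosed.exists_solution_operator`). If `u` is the solution starting at `R y`, then
`T t y = (A - r) u t` is a bounded operator on all of `X`. Since `R` maps solutions to solutions,
`T` extends the solution operators and commutes with `R`. The latter shows that the generator of
`T` is not a proper extension of `A` (`IsWellPosed.exists_semigroup`).
-/

lemma ContinuousOn.continuous_comp_max {E : Type*} [TopologicalSpace E] {f : ℝ → E}
    (hf : ContinuousOn f (Ici 0)) : Continuous fun s => f (max s 0) :=
  hf.comp_continuous (by fun_prop) fun s => le_max_right s 0

lemma ContinuousOn.intervalIntegrable_of_nonneg {E : Type*} [NormedAddCommGroup E] {f : ℝ → E}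
    (hf : ContinuousOn f (Ici 0)) {a b : ℝ} (ha : 0 ≤ a) (hb : 0 ≤ b) :
    IntervalIntegrable f MeasureTheory.volume a b :=
  (hf.mono fun _ hs => (le_min ha hb).trans hs.1).intervalIntegrable

/-! ### Solutions of the Cauchy problem, in terms of the graph of the operator -/

section Solutions

variable {X : Type*} [NormedAddCommGroup X] [NormedSpace ℝ X]

/-- `u` is a `C¹` solution of `u' = A u`, `u 0 = x` on `[0, ∞)` with derivative `v`. The condition
`v t = A (u t)` is expressed through the graph of `A`, which avoids carrying around proofs of
`u t ∈ A.domain`. -/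
structure IsGraphSolution (A : X →ₗ.[ℝ] X) (x : X) (u v : ℝ → X) : Prop where
  continuousOn : ContinuousOn v (Ici 0)
  mem_graph : ∀ t, 0 ≤ t → (u t, v t) ∈ A.graph
  hasDerivWithinAt : ∀ t, 0 ≤ t → HasDerivWithinAt u (v t) (Ici 0) t
  initial : u 0 = x

variable {A : X →ₗ.[ℝ] X} {x x' : X} {u v u' v' : ℝ → X}

lemma LinearPMap.mem_graph_apply {y : X} (h : (x, y) ∈ A.graph) :
    ∃ hx : x ∈ A.domain, A ⟨x, hx⟩ = y := by
  obtain ⟨z, hz, hz'⟩ := A.mem_graph_iff.1 h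
  simp only at hz hz'
  subst hz
  exact ⟨z.2, hz'⟩

namespace IsGraphSolution

lemma isC1Solution (h : IsGraphSolution A x u v) : IsC1Solution A x u where
  contDiffOn := by
    rw [contDiffOn_one_iff_derivWithin (uniqueDiffOn_Ici 0)]
    refine ⟨fun t ht => (h.hasDerivWithinAt t ht).differentiableWithinAt, ?_⟩
    exact h.continuousOn.congr fun t ht =>
      (h.hasDerivWithinAt t ht).derivWithin (uniqueDiffOn_Ici 0 t ht)
  mem_domain t ht := (LinearPMap.mem_graph_apply (h.mem_graph t ht)).1
  hasDerivWithinAt t ht := by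
    rw [(LinearPMap.mem_graph_apply (h.mem_graph t ht)).2]
    exact h.hasDerivWithinAt t ht
  initial := h.initial

lemma _root_.IsC1Solution.exists_isGraphSolution (h : IsC1Solution A x u) :
    ∃ v, IsGraphSolution A x u v := by
  have hd : ∀ (t : ℝ) (ht : 0 ≤ t),
      derivWithin u (Ici 0) t = A ⟨u t, h.mem_domain t ht⟩ := fun t ht =>
    (h.hasDerivWithinAt t ht).derivWithin (uniqueDiffOn_Ici 0 t ht)
  refine ⟨derivWithin u (Ici 0), ?_, fun t ht => ?_, fun t ht => ?_, h.initial⟩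
  · exact ((contDiffOn_one_iff_derivWithin (uniqueDiffOn_Ici 0)).1 h.contDiffOn).2
  · rw [hd t ht]
    exact A.mem_graph ⟨u t, h.mem_domain t ht⟩
  · rw [hd t ht]
    exact h.hasDerivWithinAt t ht

lemma continuousOn_left (h : IsGraphSolution A x u v) : ContinuousOn u (Ici 0) :=
  fun t ht => (h.hasDerivWithinAt t ht).continuousWithinAt

lemma add (h : IsGraphSolution A x u v) (h' : IsGraphSolution A x' u' v') :
    IsGraphSolution A (x + x') (u + u') (v + v') where
  continuousOn := h.continuousOn.add h'.continuousOn
  mem_graph t ht := A.graph.add_mem (h.mem_graph t ht) (h'.mem_graph t ht)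
  hasDerivWithinAt t ht := (h.hasDerivWithinAt t ht).add (h'.hasDerivWithinAt t ht)
  initial := by simp [h.initial, h'.initial]

lemma map (h : IsGraphSolution A x u v) (B : X →L[ℝ] X)
    (hB : ∀ y z, (y, z) ∈ A.graph → (B y, B z) ∈ A.graph) :
    IsGraphSolution A (B x) (fun t => B (u t)) (fun t => B (v t)) where
  continuousOn := B.continuous.comp_continuousOn h.continuousOn
  mem_graph t ht := hB _ _ (h.mem_graph t ht)
  hasDerivWithinAt t ht := B.hasFDerivAt.comp_hasDerivWithinAt t (h.hasDerivWithinAt t ht)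
  initial := by rw [h.initial]

lemma smul (h : IsGraphSolution A x u v) (c : ℝ) :
    IsGraphSolution A (c • x) (fun t => c • u t) (fun t => c • v t) :=
  h.map (c • ContinuousLinearMap.id ℝ X) fun _ _ hyz => A.graph.smul_mem c hyz

lemma shift (h : IsGraphSolution A x u v) {s : ℝ} (hs : 0 ≤ s) :
    IsGraphSolution A (u s) (fun t => u (t + s)) (fun t => v (t + s)) where
  continuousOn := h.continuousOn.comp (by fun_prop) fun t (ht : 0 ≤ t) => add_nonneg ht hs
  mem_graph t ht := h.mem_graph _ (add_nonneg ht hs)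
  hasDerivWithinAt t ht := by
    have := HasDerivWithinAt.scomp (s := Ici 0) t (h.hasDerivWithinAt (t + s) (add_nonneg ht hs))
      ((hasDerivWithinAt_id t (Ici 0)).add_const s) fun t (ht : 0 ≤ t) => add_nonneg ht hs
    simpa [Function.comp_def] using this
  initial := by simp

variable [CompleteSpace X]

lemma hasDerivWithinAt_integral {f : ℝ → X} (hf : ContinuousOn f (Ici 0)) {t : ℝ} (ht : 0 ≤ t) :
    HasDerivWithinAt (fun t => ∫ s in 0..t, f s) (f t) (Ici 0) t := by
  have h1 := (hf.continuous_comp_max.integral_hasStrictDerivAt 0 t).hasDerivAt.hasDerivWithinAt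
    (s := Ici 0)
  rw [max_eq_left ht] at h1
  have h2 : ∀ r ∈ Ici (0 : ℝ), ∫ s in 0..r, f s = ∫ s in 0..r, f (max s 0) := fun r hr => by
    refine intervalIntegral.integral_congr fun s hs => ?_
    rw [uIcc_of_le hr] at hs
    simp [max_eq_left hs.1]
  exact h1.congr h2 (h2 t ht)

lemma of_integral (hv : ContinuousOn v (Ici 0)) (hmem : ∀ t, 0 ≤ t → (u t, v t) ∈ A.graph)
    (hu : ∀ t, 0 ≤ t → u t = x + ∫ s in 0..t, v s) : IsGraphSolution A x u v where
  continuousOn := hv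
  mem_graph := hmem
  hasDerivWithinAt t ht :=
    ((hasDerivWithinAt_integral hv ht).const_add x).congr (fun t ht => hu t ht) (hu t ht)
  initial := by simp [hu 0 le_rfl]

lemma eq_add_integral (h : IsGraphSolution A x u v) {t : ℝ} (ht : 0 ≤ t) :
    u t = x + ∫ s in 0..t, v s := by
  rw [intervalIntegral.integral_eq_sub_of_hasDeriv_right_of_le ht
    (h.continuousOn_left.mono Icc_subset_Ici_self)
    (fun s hs => (h.hasDerivWithinAt s hs.1.le).mono fun r hr => hs.1.le.trans (le_of_lt hr))
    (h.continuousOn.intervalIntegrable_of_nonneg le_rfl ht), h.initial]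
  abel

/-- A solution on `[0, b]`, given in integrated form, is continued by a solution which starts at
its value at time `b`. -/
lemma glue {b : ℝ} (hb : 0 ≤ b) (hv : ContinuousOn v (Icc 0 b))
    (hmem : ∀ t ∈ Icc 0 b, (u t, v t) ∈ A.graph)
    (hu : ∀ t ∈ Icc 0 b, u t = x + ∫ s in 0..t, v s)
    (h' : IsGraphSolution A (u b) u' v') :
    IsGraphSolution A x (fun t => if t ≤ b then u t else u' (t - b))
      (fun t => if t ≤ b then v t else v' (t - b)) := by
  -- The derivatives agree at the joint, since both are the value of `A` at `u b`.
  have hvb : v b = v' 0 := A.mem_graph_snd_inj (hmem b ⟨hb, le_rfl⟩) (h'.mem_graph 0 le_rfl)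
    h'.initial.symm
  have hcont : ContinuousOn (fun t => if t ≤ b then v t else v' (t - b)) (Ici 0) := by
    refine ContinuousOn.if ?_ ?_ ?_
    · rintro t ⟨-, ht⟩
      rw [show {a : ℝ | a ≤ b} = Iic b from rfl, frontier_Iic] at ht
      rw [mem_singleton_iff.1 ht, sub_self, hvb]
    · refine hv.mono ?_
      rw [show {a : ℝ | a ≤ b} = Iic b from rfl, closure_Iic]
      exact fun t ht => ht
    · refine h'.continuousOn.comp (by fun_prop) ?_
      rw [show {a : ℝ | ¬ a ≤ b} = Ioi b by ext; simp, closure_Ioi]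
      exact fun t ht => mem_Ici.2 (sub_nonneg.2 ht.2)
  refine of_integral hcont (fun t ht => ?_) fun t ht => ?_
  · by_cases htb : t ≤ b
    · simpa [htb] using hmem t ⟨ht, htb⟩
    · simpa [htb] using h'.mem_graph (t - b) (by linarith)
  · have key : ∀ r ∈ Icc 0 b, u r = x + ∫ s in 0..r, if s ≤ b then v s else v' (s - b) := by
      intro r hr
      rw [hu r hr]
      congr 1
      refine intervalIntegral.integral_congr fun s hs => ?_
      rw [uIcc_of_le hr.1] at hs
      simp [hs.2.trans hr.2]
    by_cases htb : t ≤ b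
    · simpa [htb] using key t ⟨ht, htb⟩
    · have hbt : b ≤ t := (not_le.1 htb).le
      have h2 : ∫ s in b..t, (if s ≤ b then v s else v' (s - b)) = ∫ s in 0..(t - b), v' s := by
        rw [← sub_self b, ← intervalIntegral.integral_comp_sub_right]
        refine intervalIntegral.integral_congr fun s hs => ?_
        rw [uIcc_of_le hbt] at hs
        rcases hs.1.eq_or_lt with rfl | hs'
        · simp [hvb]
        · simp [not_le.2 hs']
      rw [← intervalIntegral.integral_add_adjacent_intervals
        (hcont.intervalIntegrable_of_nonneg le_rfl hb)
        (hcont.intervalIntegrable_of_nonneg hb ht), ← add_assoc, ← key b ⟨hb, le_rfl⟩, h2]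
      simpa [htb] using h'.eq_add_integral (sub_nonneg.2 hbt)

end IsGraphSolution

end Solutions

/-! ### Real resolvents -/

section Resolvent

variable {X : Type*} [NormedAddCommGroup X] [NormedSpace ℝ X] {A : X →ₗ.[ℝ] X} {r : ℝ}
  {R : X →L[ℝ] X}

/-- `R` is the inverse of `A - r`, defined on all of `X`. -/
structure IsRealResolvent (A : X →ₗ.[ℝ] X) (r : ℝ) (R : X →L[ℝ] X) : Prop where
  mem_graph : ∀ y, (R y, y + r • R y) ∈ A.graph
  apply_sub : ∀ x y, (x, y) ∈ A.graph → R (y - r • x) = x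

namespace IsRealResolvent

lemma map_graph (hR : IsRealResolvent A r R) (x y : X) (h : (x, y) ∈ A.graph) :
    (R x, R y) ∈ A.graph := by
  have h1 : R y = x + r • R x := by
    rw [← sub_eq_iff_eq_add, ← map_smul, ← map_sub, hR.apply_sub x y h]
  rw [h1]
  exact hR.mem_graph x

/-- The resolvent commutes with every bounded operator that commutes with `A`. -/
lemma commute (hR : IsRealResolvent A r R) (B : X →L[ℝ] X)
    (hB : ∀ x y, (x, y) ∈ A.graph → (B x, B y) ∈ A.graph) (y : X) : R (B y) = B (R y) := by
  simpa using hR.apply_sub _ _ (hB _ _ (hR.mem_graph y))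

/-- If `A` is closed and `A - r` is a bijection, then its inverse is bounded, by the closed graph
theorem. -/
lemma exists_of_bijective [CompleteSpace X] (hA : A.IsClosed)
    (hinj : ∀ x, (x, r • x) ∈ A.graph → x = 0) (hsurj : ∀ y, ∃ x, (x, y + r • x) ∈ A.graph) :
    ∃ R : X →L[ℝ] X, IsRealResolvent A r R := by
  choose f hf using hsurj
  have huniq : ∀ x y, (x, y + r • x) ∈ A.graph → x = f y := fun x y h => by
    rw [← sub_eq_zero]
    apply hinj
    have h1 := A.graph.sub_mem h (hf y)
    rwa [Prod.mk_sub_mk, add_sub_add_left_eq_sub, ← smul_sub] at h1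
  let g : X →ₗ[ℝ] X :=
    { toFun := f
      map_add' := fun y z => (huniq _ _ (by
        have h1 := A.graph.add_mem (hf y) (hf z)
        rwa [Prod.mk_add_mk, add_add_add_comm, ← smul_add] at h1)).symm
      map_smul' := fun c y => (huniq _ _ (by
        have h1 := A.graph.smul_mem c (hf y)
        rwa [Prod.smul_mk, smul_add, smul_comm c r] at h1)).symm }
  have hg : IsClosed (g.graph : Set (X × X)) := by
    have h1 : (g.graph : Set (X × X)) =
        (fun p : X × X => (p.2, p.1 + r • p.2)) ⁻¹' (A.graph : Set (X × X)) := by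
      ext ⟨y, x⟩
      simp only [SetLike.mem_coe, LinearMap.mem_graph_iff, mem_preimage]
      exact ⟨fun h => h ▸ hf y, huniq x y⟩
    rw [h1]
    exact IsClosed.preimage (by fun_prop) hA
  refine ⟨ContinuousLinearMap.ofIsClosedGraph hg, hf, fun x y h => ?_⟩
  exact (huniq x _ (by simpa using h)).symm

end IsRealResolvent

end Resolvent

/-! ### Boundedness of the solution operators -/

section WellPosed

variable {X : Type*} [NormedAddCommGroup X] [NormedSpace ℝ X]

/-- The Cauchy problem `u' = A u`, `u 0 = x` has a unique `C¹` solution on `[0, ∞)` for every `x`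
in the domain of `A`. -/
structure IsWellPosed (A : X →ₗ.[ℝ] X) : Prop where
  exists_solution : ∀ x y, (x, y) ∈ A.graph → ∃ u v, IsGraphSolution A x u v
  unique : ∀ {x : X} {u v u' v' : ℝ → X}, IsGraphSolution A x u v → IsGraphSolution A x u' v' →
    EqOn u u' (Ici 0)

variable {A : X →ₗ.[ℝ] X} {x y : X} {u v u' v' : ℝ → X}

namespace IsWellPosed

lemma unique_right (hw : IsWellPosed A) (h : IsGraphSolution A x u v)
    (h' : IsGraphSolution A x u' v') : EqOn v v' (Ici 0) := fun t ht =>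
  A.mem_graph_snd_inj (h.mem_graph t ht) (h'.mem_graph t ht) (hw.unique h h' ht)

/-- For each `b ≥ 0` the map `(x, A x) ↦ (u b, A (u b))`, where `u` is the solution that starts at
`x`, is bounded for the graph norm. This is the closed graph theorem for the map that sends
`(x, A x)` to `(u, A u) ∈ C([0, b], X × X)`. -/
lemma exists_solution_operator [CompleteSpace X] (hA : A.IsClosed) (hw : IsWellPosed A) {b : ℝ}
    (hb : 0 ≤ b) : ∃ L : A.graph →L[ℝ] X × X, ∀ (g : A.graph) (u v : ℝ → X),
      IsGraphSolution A g.1.1 u v → L g = (u b, v b) := by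
  have : CompleteSpace A.graph := hA.completeSpace_coe
  choose U V hUV using fun g : A.graph => hw.exists_solution g.1.1 g.1.2 g.2
  let Φ : A.graph →ₗ[ℝ] C(Icc 0 b, X × X) :=
    { toFun := fun g => ⟨fun t => (U g t, V g t), by
        have h1 := (hUV g).continuousOn_left
        have h2 := (hUV g).continuousOn
        exact (h1.comp_continuous continuous_subtype_val fun t => t.2.1).prodMk
          (h2.comp_continuous continuous_subtype_val fun t => t.2.1)⟩
      map_add' := fun g g' => by
        ext t
        · exact hw.unique (hUV (g + g')) ((hUV g).add (hUV g')) t.2.1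
        · exact hw.unique_right (hUV (g + g')) ((hUV g).add (hUV g')) t.2.1
      map_smul' := fun c g => by
        ext t
        · exact hw.unique (hUV (c • g)) ((hUV g).smul c) t.2.1
        · exact hw.unique_right (hUV (c • g)) ((hUV g).smul c) t.2.1 }
  have hΦ : ∀ (g : A.graph) (t : Icc 0 b), Φ g t = (U g t, V g t) := fun g t => rfl
  -- The graph of `Φ` is cut out by the closed conditions `f t ∈ A.graph` and
  -- `(f t).1 = x + ∫ s in 0..t, (f s).2`.
  have hgraph : (Φ.graph : Set (A.graph × C(Icc 0 b, X × X))) = ⋂ t : Icc 0 b,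
      {p | p.2 t ∈ A.graph} ∩
      {p | (p.2 t).1 = p.1.1.1 + ∫ s in 0..(t : ℝ), (p.2 (projIcc 0 b hb s)).2} := by
    ext ⟨g, f⟩
    simp only [SetLike.mem_coe, LinearMap.mem_graph_iff, mem_iInter, mem_inter_iff, mem_ofPred_eq]
    constructor
    · rintro rfl t
      refine ⟨(hUV g).mem_graph t t.2.1, ?_⟩
      change U g t = _
      rw [(hUV g).eq_add_integral t.2.1]
      congr 1
      refine intervalIntegral.integral_congr fun s hs => ?_
      rw [uIcc_of_le t.2.1] at hs
      simp only [hΦ, projIcc_of_mem hb ⟨hs.1, hs.2.trans t.2.2⟩]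
    · intro h
      obtain ⟨u', v', h'⟩ := hw.exists_solution (f ⟨b, hb, le_rfl⟩).1 _ (h ⟨b, hb, le_rfl⟩).1
      have hglue := IsGraphSolution.glue (A := A) (x := g.1.1)
        (u := fun t => (f (projIcc 0 b hb t)).1) (v := fun t => (f (projIcc 0 b hb t)).2)
        (u' := u') (v' := v') hb (by fun_prop)
        (fun t _ => (h (projIcc 0 b hb t)).1)
        (fun t ht => by simpa [projIcc_of_mem hb ht] using (h ⟨t, ht⟩).2)
        (by simpa [projIcc_of_mem hb (right_mem_Icc.2 hb)] using h')
      ext t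
      · have := hw.unique hglue (hUV g) t.2.1
        simpa [t.2.2, hΦ] using this
      · have := hw.unique_right hglue (hUV g) t.2.1
        simpa [t.2.2, hΦ] using this
  have hclosed : IsClosed (Φ.graph : Set (A.graph × C(Icc 0 b, X × X))) := by
    rw [hgraph]
    refine isClosed_iInter fun t => IsClosed.inter ?_ ?_
    · exact IsClosed.preimage (f := fun p : A.graph × C(Icc 0 b, X × X) => p.2 t) (by fun_prop) hA
    · refine isClosed_eq (by fun_prop) (Continuous.add (by fun_prop) ?_)
      refine intervalIntegral.continuous_parametric_intervalIntegral_of_continuous' ?_ _ _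
      unfold Function.uncurry
      fun_prop
  let bI : Icc 0 b := ⟨b, hb, le_rfl⟩
  refine ⟨(ContinuousMap.evalCLM ℝ bI).comp (ContinuousLinearMap.ofIsClosedGraph hclosed),
    fun g u v h => ?_⟩
  exact Prod.ext (hw.unique (hUV g) h hb) (hw.unique_right (hUV g) h hb)

/-! ### From well-posedness to a semigroup -/

/-- The operators `y ↦ (A - r) u t`, where `u` is the solution with initial value
`R y = (A - r)⁻¹ y`. They extend the solution operators `x ↦ u t` from the domain of `A` to all
of `X`, since `R` maps solutions to solutions. -/
lemma exists_semigroup_operator [CompleteSpace X] (hA : A.IsClosed) (hw : IsWellPosed A) {r : ℝ}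
    {R : X →L[ℝ] X} (hR : IsRealResolvent A r R) :
    ∃ T : ℝ → X →L[ℝ] X, ∀ t, 0 ≤ t → ∀ (y : X) (u v : ℝ → X),
      IsGraphSolution A (R y) u v → T t y = v t - r • u t := by
  have key : ∀ t : ℝ, ∃ T : X →L[ℝ] X, 0 ≤ t → ∀ (y : X) (u v : ℝ → X),
      IsGraphSolution A (R y) u v → T y = v t - r • u t := by
    intro t
    by_cases ht : 0 ≤ t
    · obtain ⟨L, hL⟩ := exists_solution_operator hA hw ht
      let G : X →L[ℝ] A.graph :=
        (R.prod (ContinuousLinearMap.id ℝ X + r • R)).codRestrict A.graph hR.mem_graph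
      refine ⟨(ContinuousLinearMap.snd ℝ X X - r • ContinuousLinearMap.fst ℝ X X).comp
        (L.comp G), fun _ y u v h => ?_⟩
      have := hL (G y) u v h
      simp [this]
    · exact ⟨0, fun h => absurd h ht⟩
  choose T hT using key
  exact ⟨T, hT⟩

variable {r : ℝ} {R : X →L[ℝ] X} {T : ℝ → X →L[ℝ] X}

/-- `T t x` is the solution with initial value `x`, for `x` in the domain of `A`. -/
lemma semigroup_operator_apply (hR : IsRealResolvent A r R)
    (hT : ∀ t, 0 ≤ t → ∀ (y : X) (u v : ℝ → X),
      IsGraphSolution A (R y) u v → T t y = v t - r • u t)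
    (h : IsGraphSolution A x u v) {t : ℝ} (ht : 0 ≤ t) : T t x = u t := by
  rw [hT t ht x _ _ (h.map R hR.map_graph), ← map_smul, ← map_sub,
    hR.apply_sub _ _ (h.mem_graph t ht)]

/-- `T t` commutes with every bounded operator that commutes with `A`. -/
lemma semigroup_operator_commute (hw : IsWellPosed A) (hR : IsRealResolvent A r R)
    (hT : ∀ t, 0 ≤ t → ∀ (y : X) (u v : ℝ → X),
      IsGraphSolution A (R y) u v → T t y = v t - r • u t)
    (B : X →L[ℝ] X) (hB : ∀ x y, (x, y) ∈ A.graph → (B x, B y) ∈ A.graph) {t : ℝ} (ht : 0 ≤ t)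
    (y : X) : T t (B y) = B (T t y) := by
  obtain ⟨u, v, h⟩ := hw.exists_solution _ _ (hR.mem_graph y)
  have h' := h.map B hB
  rw [← hR.commute B hB] at h'
  rw [hT t ht y u v h, hT t ht (B y) _ _ h', map_sub, map_smul]

/-- If the Cauchy problem is well posed and `A` has a real resolvent, then `A` is a generator. Only
`hlin` refers to `𝔸`: right multiplications are bounded operators that commute with `A`. -/
theorem exists_semigroup (𝔸 : Type*) [SMul 𝔸ᵐᵒᵖ X] [CompleteSpace X] (hA : A.IsClosed)
    (hw : IsWellPosed A) (hR : IsRealResolvent A r R)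
    (hlin : ∀ α : 𝔸, ∃ B : X →L[ℝ] X, (∀ x, B x = MulOpposite.op α • x) ∧
      ∀ x y, (x, y) ∈ A.graph → (B x, B y) ∈ A.graph) :
    ∃ T : ℝ → X →L[ℝ] X, IsStronglyContinuousSemigroup 𝔸 T ∧ IsGenerator A T := by
  obtain ⟨T, hT⟩ := exists_semigroup_operator hA hw hR
  have hsol : ∀ y, ∃ u v, IsGraphSolution A (R y) u v := fun y =>
    hw.exists_solution _ _ (hR.mem_graph y)
  have hgen : ∀ x y, (x, y) ∈ A.graph →
      Tendsto (fun h : ℝ => h⁻¹ • (T h x - x)) (𝓝[>] 0) (𝓝 y) := by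
    intro x y hxy
    obtain ⟨u, v, h⟩ := hw.exists_solution x y hxy
    have hv : v 0 = y := A.mem_graph_snd_inj (h.mem_graph 0 le_rfl) hxy h.initial
    have h1 := (hasDerivWithinAt_iff_tendsto_slope' self_notMem_Ioi).1
      (hasDerivWithinAt_Ioi_iff_Ici.2 (h.hasDerivWithinAt 0 le_rfl))
    rw [hv] at h1
    refine h1.congr' ?_
    filter_upwards [self_mem_nhdsWithin] with t ht
    rw [semigroup_operator_apply hR hT h (le_of_lt ht)]
    simp [slope_def_module, h.initial]
  refine ⟨T, ⟨?_, ?_, ?_, ?_⟩, ⟨?_, ?_⟩⟩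
  · intro t ht α y
    obtain ⟨B, hB, hBA⟩ := hlin α
    rw [← hB, ← hB, semigroup_operator_commute hw hR hT B hBA ht]
  · ext y
    obtain ⟨u, v, h⟩ := hsol y
    have h0 := h.mem_graph 0 le_rfl
    rw [hT 0 le_rfl y u v h, h.initial, A.mem_graph_snd_inj h0 (hR.mem_graph y) h.initial]
    simp
  · intro t s ht hs
    ext y
    obtain ⟨u, v, h⟩ := hsol y
    have hRT : R (T s y) = u s := by
      rw [hT s hs y u v h, hR.apply_sub _ _ (h.mem_graph s hs)]
    rw [ContinuousLinearMap.comp_apply, hT (t + s) (add_nonneg ht hs) y u v h,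
      hT t ht (T s y) _ _ (hRT ▸ h.shift hs)]
  · intro y
    obtain ⟨u, v, h⟩ := hsol y
    exact (h.continuousOn.sub (h.continuousOn_left.const_smul r)).congr
      fun t ht => hT t ht y u v h
  · refine fun x => ⟨fun hx => ⟨_, hgen x _ (A.mem_graph ⟨x, hx⟩)⟩, ?_⟩
    rintro ⟨y, hy⟩
    -- Applying `R` to the difference quotients shows `R y = A (R x) = x + r R x`, so that
    -- `x = R (y - r x)` lies in the domain.
    have h1 : Tendsto (fun h : ℝ => h⁻¹ • (T h (R x) - R x)) (𝓝[>] 0) (𝓝 (R y)) := by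
      refine ((R.continuous.tendsto y).comp hy).congr' ?_
      filter_upwards [self_mem_nhdsWithin] with t ht
      simp [semigroup_operator_commute hw hR hT R hR.map_graph (le_of_lt ht)]
    have h2 := tendsto_nhds_unique h1 (hgen _ _ (hR.mem_graph x))
    have h3 : R (y - r • x) = x := by rw [map_sub, map_smul, h2, add_sub_cancel_right]
    rw [← h3]
    exact (LinearPMap.mem_graph_apply (hR.mem_graph _)).1
  · exact fun x => hgen x _ (A.mem_graph x)

end IsWellPosed

end WellPosed

/-! ### Orbits of a strongly continuous semigroup -/

section Semigroup

variable {𝔸 X : Type*} [NormedAddCommGroup X] [NormedSpace ℝ X] [SMul 𝔸ᵐᵒᵖ X]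
  {T : ℝ → X →L[ℝ] X} {A : X →ₗ.[ℝ] X} {x y : X}

namespace IsStronglyContinuousSemigroup

lemma apply_zero (hT : IsStronglyContinuousSemigroup 𝔸 T) (x : X) : T 0 x = x := by
  rw [hT.map_zero, ContinuousLinearMap.id_apply]

lemma apply_add (hT : IsStronglyContinuousSemigroup 𝔸 T) {t s : ℝ} (ht : 0 ≤ t) (hs : 0 ≤ s)
    (x : X) : T (t + s) x = T t (T s x) := by
  rw [hT.map_add t s ht hs, ContinuousLinearMap.comp_apply]

lemma exists_norm_le [CompleteSpace X] (hT : IsStronglyContinuousSemigroup 𝔸 T) (b : ℝ) :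
    ∃ M, ∀ t ∈ Icc 0 b, ‖T t‖ ≤ M := by
  obtain ⟨M, hM⟩ := banach_steinhaus (g := fun t : Icc 0 b => T t) fun x => by
    obtain ⟨C, hC⟩ := isCompact_Icc.exists_bound_of_continuousOn
      ((hT.strongly_continuous x).mono fun t (ht : t ∈ Icc 0 b) => ht.1)
    exact ⟨C, fun t => hC t t.2⟩
  exact ⟨M, fun t ht => hM ⟨t, ht⟩⟩

/-- Joint continuity of `(t, z) ↦ T t z`. -/
lemma tendsto_apply [CompleteSpace X] (hT : IsStronglyContinuousSemigroup 𝔸 T) {ι : Type*}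
    {l : Filter ι} {τ : ι → ℝ} {z : ι → X} {τ₀ b : ℝ} {z₀ : X} (hτ : Tendsto τ l (𝓝 τ₀))
    (hmem : ∀ᶠ i in l, τ i ∈ Icc 0 b) (hτ₀ : 0 ≤ τ₀) (hz : Tendsto z l (𝓝 z₀)) :
    Tendsto (fun i => T (τ i) (z i)) l (𝓝 (T τ₀ z₀)) := by
  obtain ⟨M, hM⟩ := hT.exists_norm_le b
  have h1 : Tendsto (fun i => T (τ i) z₀) l (𝓝 (T τ₀ z₀)) :=
    (hT.strongly_continuous z₀ τ₀ hτ₀).tendsto.comp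
      (tendsto_nhdsWithin_iff.2 ⟨hτ, hmem.mono fun i hi => hi.1⟩)
  have h2 : Tendsto (fun i => T (τ i) (z i - z₀)) l (𝓝 0) := by
    refine squeeze_zero_norm' (a := fun i => M * ‖z i - z₀‖) ?_ ?_
    · filter_upwards [hmem] with i hi using (T (τ i)).le_of_opNorm_le (hM _ hi) _
    · simpa using ((hz.sub_const z₀).norm.const_mul M)
  simpa using h2.add h1

lemma hasDerivWithinAt_iff_tendsto (hT : IsStronglyContinuousSemigroup 𝔸 T) :
    HasDerivWithinAt (fun t => T t x) y (Ici 0) 0 ↔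
      Tendsto (fun h : ℝ => h⁻¹ • (T h x - x)) (𝓝[>] 0) (𝓝 y) := by
  rw [← hasDerivWithinAt_Ioi_iff_Ici, hasDerivWithinAt_iff_tendsto_slope' self_notMem_Ioi]
  simp [slope_fun_def, hT.apply_zero]

lemma mem_graph_iff (hT : IsStronglyContinuousSemigroup 𝔸 T) (hA : IsGenerator A T) :
    (x, y) ∈ A.graph ↔ HasDerivWithinAt (fun t => T t x) y (Ici 0) 0 := by
  rw [hT.hasDerivWithinAt_iff_tendsto]
  constructor
  · intro h
    obtain ⟨hx, rfl⟩ := LinearPMap.mem_graph_apply h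
    exact hA.tendsto ⟨x, hx⟩
  · intro h
    have hx := (hA.mem_domain_iff x).2 ⟨y, h⟩
    rw [← tendsto_nhds_unique (hA.tendsto ⟨x, hx⟩) h]
    exact A.mem_graph ⟨x, hx⟩

lemma map_graph (hT : IsStronglyContinuousSemigroup 𝔸 T) (hA : IsGenerator A T)
    (h : (x, y) ∈ A.graph) {t : ℝ} (ht : 0 ≤ t) : (T t x, T t y) ∈ A.graph := by
  rw [hT.mem_graph_iff hA] at h ⊢
  have hcomm : ∀ s ∈ Ici (0 : ℝ), T s (T t x) = T t (T s x) := fun s hs => by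
    rw [← hT.apply_add hs ht, add_comm, hT.apply_add ht hs]
  exact ((T t).hasFDerivAt.comp_hasDerivWithinAt 0 h).congr hcomm (hcomm 0 self_mem_Ici)

lemma hasDerivWithinAt_right (hT : IsStronglyContinuousSemigroup 𝔸 T) (hA : IsGenerator A T)
    (h : (x, y) ∈ A.graph) {t : ℝ} (ht : 0 ≤ t) :
    HasDerivWithinAt (fun s => T s x) (T t y) (Ici t) t := by
  have h1 := (hT.mem_graph_iff hA).1 (hT.map_graph hA h ht)
  rw [← sub_self t] at h1
  have h2 := HasDerivWithinAt.scomp (h := fun s => s - t) (s := Ici t) t h1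
    ((hasDerivWithinAt_id t (Ici t)).sub_const t) fun s (hs : t ≤ s) => by simpa using hs
  rw [one_smul] at h2
  have h3 : ∀ s ∈ Ici t, T s x = T (s - t) (T t x) := fun s hs => by
    rw [← hT.apply_add (sub_nonneg.2 hs) ht, sub_add_cancel]
  exact h2.congr h3 (h3 t self_mem_Ici)

/-- For `x` in the domain of the generator the orbit of `x` is a `C¹` solution: its right
derivative is the continuous function `t ↦ T t (A x)`, hence it is an integral of this function. -/
lemma isGraphSolution [CompleteSpace X] (hT : IsStronglyContinuousSemigroup 𝔸 T)
    (hA : IsGenerator A T) (h : (x, y) ∈ A.graph) :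
    IsGraphSolution A x (fun t => T t x) (fun t => T t y) := by
  refine IsGraphSolution.of_integral (hT.strongly_continuous y)
    (fun t ht => hT.map_graph hA h ht) fun t ht => ?_
  have hint : ∀ s, 0 ≤ s → HasDerivWithinAt (fun t => ∫ r in 0..t, T r y) (T s y) (Ici 0) s :=
    fun s hs => IsGraphSolution.hasDerivWithinAt_integral (hT.strongly_continuous y) hs
  have hconst := constant_of_has_deriv_right_zero (a := 0) (b := t)
    (f := fun s => T s x - ∫ r in 0..s, T r y) ?_ ?_ t ⟨ht, le_rfl⟩
  · simp only [intervalIntegral.integral_same, hT.apply_zero, sub_zero] at hconst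
    rw [← sub_eq_iff_eq_add, hconst]
  · refine ((hT.strongly_continuous x).sub fun s hs => ?_).mono Icc_subset_Ici_self
    exact (hint s hs).continuousWithinAt
  · intro s hs
    rw [← sub_self (T s y)]
    exact (hT.hasDerivWithinAt_right hA h hs.1).sub
      ((hint s hs.1).mono (Ici_subset_Ici.2 hs.1))

/-- For a solution `u`, the function `s ↦ T (t - s) (u s)` is constant on `[0, t]`. -/
lemma eq_of_isGraphSolution [CompleteSpace X] (hT : IsStronglyContinuousSemigroup 𝔸 T)
    (hA : IsGenerator A T) {u v : ℝ → X} (h : IsGraphSolution A x u v) {t : ℝ} (ht : 0 ≤ t) :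
    u t = T t x := by
  have hconst := constant_of_has_deriv_right_zero (a := 0) (b := t)
    (f := fun s => T (t - s) (u s)) ?_ ?_ t ⟨ht, le_rfl⟩
  · simpa [hT.apply_zero, h.initial] using hconst
  · intro s hs
    refine hT.tendsto_apply (b := t) ?_ ?_ (sub_nonneg.2 hs.2) ?_
    · exact ((continuous_const.sub continuous_id).tendsto s).mono_left nhdsWithin_le_nhds
    · filter_upwards [self_mem_nhdsWithin] with r hr
      exact ⟨sub_nonneg.2 hr.2, sub_le_self _ hr.1⟩
    · exact (h.continuousOn_left s hs.1).mono Icc_subset_Ici_self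
  · intro s hs
    rw [← hasDerivWithinAt_Ioi_iff_Ici, hasDerivWithinAt_iff_tendsto_slope' self_notMem_Ioi]
    have h1 : Tendsto (slope u s) (𝓝[>] s) (𝓝 (v s)) :=
      (hasDerivWithinAt_iff_tendsto_slope' self_notMem_Ioi).1
        ((h.hasDerivWithinAt s hs.1).mono fun r hr => hs.1.trans (le_of_lt hr))
    -- The orbit of `u s`, started at time `s`, has the same derivative at `s` as `u`.
    have h2 : Tendsto (slope (fun r => T (r - s) (u s)) s) (𝓝[>] s) (𝓝 (v s)) := by
      have h3 := (hT.mem_graph_iff hA).1 (h.mem_graph s hs.1)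
      rw [← sub_self s] at h3
      have h4 := HasDerivWithinAt.scomp (h := fun r => r - s) (s := Ici s) s h3
        ((hasDerivWithinAt_id s (Ici s)).sub_const s) fun r (hr : s ≤ r) => by simpa using hr
      rw [one_smul] at h4
      exact (hasDerivWithinAt_iff_tendsto_slope' self_notMem_Ioi).1
        (hasDerivWithinAt_Ioi_iff_Ici.2 h4)
    have h5 := hT.tendsto_apply (l := 𝓝[>] s) (τ := fun r => t - r) (τ₀ := t - s) (b := t)
      (((continuous_const.sub continuous_id).tendsto s).mono_left nhdsWithin_le_nhds) (by
        filter_upwards [Ioc_mem_nhdsGT hs.2] with r hr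
        exact ⟨sub_nonneg.2 hr.2, sub_le_self _ (hs.1.trans hr.1.le)⟩)
      (sub_nonneg.2 hs.2.le) (h1.sub h2)
    rw [sub_self, _root_.map_zero] at h5
    refine h5.congr' ?_
    filter_upwards [Ioc_mem_nhdsGT hs.2] with r hr
    have h6 : T (t - s) (u s) = T (t - r) (T (r - s) (u s)) := by
      rw [← hT.apply_add (sub_nonneg.2 hr.2) (sub_nonneg.2 hr.1.le), sub_add_sub_cancel]
    simp only [slope_def_module, h6, sub_self, hT.apply_zero, ← smul_sub, ← map_sub, map_smul]
    congr 2
    abel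

/-! ### The real resolvent of a generator -/

/-- For large `l` the operator `A - l` is invertible. With `S t = exp (-l t) T t` and
`K = ∫ s in 0..1, S s` one has `(A - l) K = S 1 - 1`, which is invertible as soon as `‖S 1‖ < 1`. -/
lemma exists_isRealResolvent [CompleteSpace X] (hT : IsStronglyContinuousSemigroup 𝔸 T)
    (hA : IsGenerator A T) (hclosed : A.IsClosed) :
    ∃ (l : ℝ) (R : X →L[ℝ] X), IsRealResolvent A l R := by
  obtain ⟨l, hl⟩ : ∃ l : ℝ, ‖Real.exp (-l) • T 1‖ < 1 := by
    have hpos : 0 < ‖T 1‖ + 1 := by positivity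
    refine ⟨Real.log (‖T 1‖ + 1), ?_⟩
    rw [norm_smul, Real.exp_neg, Real.exp_log hpos, norm_inv, Real.norm_of_nonneg hpos.le,
      inv_mul_lt_one₀ hpos]
    linarith
  have hunit : IsUnit (1 - Real.exp (-l) • T 1) := isUnit_one_sub_of_norm_lt_one hl
  refine ⟨l, IsRealResolvent.exists_of_bijective hclosed ?_ ?_⟩
  · intro x hx
    -- The function `t ↦ exp (l t) x` solves the Cauchy problem, so it is the orbit of `x`.
    have hsol : IsGraphSolution A x (fun t => Real.exp (t * l) • x)
        (fun t => Real.exp (t * l) • l • x) :=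
      { continuousOn := by fun_prop
        mem_graph := fun t _ => A.graph.smul_mem _ hx
        hasDerivWithinAt := fun t _ => by
          rw [smul_smul]
          have h1 : HasDerivAt (fun t : ℝ => Real.exp (t * l)) (Real.exp (t * l) * l) t := by
            simpa using ((hasDerivAt_id t).mul_const l).exp
          exact (h1.smul_const x).hasDerivWithinAt
        initial := by simp }
    have h1 := hT.eq_of_isGraphSolution hA hsol zero_le_one
    have h2 : (1 - Real.exp (-l) • T 1) x = 0 := by
      simp [← h1, smul_smul, ← Real.exp_add]
    obtain ⟨B, hB⟩ := hunit.exists_left_inv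
    have h3 := congrArg (fun C : X →L[ℝ] X => C x) hB
    simpa [h2] using h3.symm
  · intro y
    obtain ⟨B, hB⟩ := hunit.exists_right_inv
    set z : X := -B y with hz
    have hzy : Real.exp (-l) • T 1 z - z = y := by
      have h3 := congrArg (fun C : X →L[ℝ] X => C y) hB
      simpa [hz, sub_eq_neg_add, add_comm] using h3
    set S : ℝ → X := fun t => Real.exp (-(t * l)) • T t z with hS
    have hScont : ContinuousOn S (Ici 0) :=
      ContinuousOn.smul (by fun_prop) (hT.strongly_continuous z)
    set F : ℝ → X := fun t => ∫ s in 0..t, S s with hF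
    refine ⟨F 1, ?_⟩
    rw [hT.mem_graph_iff hA]
    have hTF : ∀ t ∈ Ici (0 : ℝ), T t (F 1) = Real.exp (t * l) • (F (t + 1) - F t) := by
      intro t ht
      have h1 : F (t + 1) - F t = ∫ s in t..(t + 1), S s := by
        rw [sub_eq_iff_eq_add']
        exact (intervalIntegral.integral_add_adjacent_intervals
          (hScont.intervalIntegrable_of_nonneg le_rfl ht)
          (hScont.intervalIntegrable_of_nonneg ht (add_nonneg ht zero_le_one))).symm
      have h2 : ∫ s in t..(t + 1), S s = ∫ s in 0..1, S (t + s) := by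
        rw [intervalIntegral.integral_comp_add_left]
        simp
      rw [h1, h2, hF, ← ContinuousLinearMap.intervalIntegral_comp_comm _
        (hScont.intervalIntegrable_of_nonneg le_rfl zero_le_one),
        ← intervalIntegral.integral_smul]
      refine intervalIntegral.integral_congr fun s hs => ?_
      rw [uIcc_of_le zero_le_one] at hs
      simp only [hS, map_smul, smul_smul, ← Real.exp_add, hT.apply_add ht hs.1]
      congr 2
      ring
    have hd : ∀ t, 0 ≤ t → HasDerivWithinAt F (S t) (Ici 0) t := fun t ht =>
      IsGraphSolution.hasDerivWithinAt_integral hScont ht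
    have hd1 : HasDerivWithinAt (fun t => F (t + 1)) (S 1) (Ici 0) 0 := by
      have h1 := hd 1 zero_le_one
      rw [← zero_add (1 : ℝ)] at h1
      have h2 := HasDerivWithinAt.scomp (s := Ici 0) 0 h1
        ((hasDerivWithinAt_id 0 (Ici 0)).add_const 1)
        fun t (ht : 0 ≤ t) => add_nonneg ht zero_le_one
      simpa [Function.comp_def] using h2
    have hexp : HasDerivWithinAt (fun t : ℝ => Real.exp (t * l)) l (Ici 0) 0 := by
      have h1 := ((hasDerivAt_id (0 : ℝ)).mul_const l).exp
      simpa using h1.hasDerivWithinAt (s := Ici 0)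
    have h3 := (hexp.smul (hd1.sub (hd 0 le_rfl))).congr hTF (hTF 0 self_mem_Ici)
    convert h3 using 1
    have hF0 : F 0 = 0 := by simp [hF]
    simp [hS, hF0, hT.apply_zero, hzy]

end IsStronglyContinuousSemigroup

end Semigroup

/-! ### Real points of the spherical resolvent set -/

section Spherical

variable {𝔸 X : Type*} [NonAssocRing 𝔸] [Module ℝ 𝔸] [StarRing 𝔸] [Norm 𝔸]
  [NormedAddCommGroup X] [NormedSpace ℝ X] [SMul 𝔸 X] [SMul 𝔸ᵐᵒᵖ X]
  [NormedAlternativeBimodule 𝔸 X] {A : X →ₗ.[ℝ] X} {r : ℝ}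

/-- Right multiplication by `α`, as a bounded operator. It is additive and bounded by hypothesis,
hence continuous, hence real linear, also when `𝔸` is not associative. -/
lemma exists_clm_eq_op_smul (X : Type*) [NormedAddCommGroup X] [NormedSpace ℝ X] [SMul 𝔸 X]
    [SMul 𝔸ᵐᵒᵖ X] [NormedAlternativeBimodule 𝔸 X] (α : 𝔸) :
    ∃ B : X →L[ℝ] X, ∀ x, B x = MulOpposite.op α • x := by
  let f : X →+ X := AddMonoidHom.mk' (fun x => MulOpposite.op α • x)
    (NormedAlternativeBimodule.right_smul_add (𝔸 := 𝔸) α)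
  have hf : Continuous f := AddMonoidHomClass.continuous_of_bound f ‖α‖
    (NormedAlternativeBimodule.norm_right_smul_le (𝔸 := 𝔸) α)
  exact ⟨f.toRealLinearMap hf, fun x => rfl⟩

lemma IsRightLinear.exists_clm (hlin : IsRightLinear 𝔸 A) (α : 𝔸) :
    ∃ B : X →L[ℝ] X, (∀ x, B x = MulOpposite.op α • x) ∧
      ∀ x y, (x, y) ∈ A.graph → (B x, B y) ∈ A.graph := by
  obtain ⟨B, hB⟩ := exists_clm_eq_op_smul X α
  refine ⟨B, hB, fun x y h => ?_⟩
  obtain ⟨hx, rfl⟩ := LinearPMap.mem_graph_apply h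
  obtain ⟨hx', h'⟩ := hlin α ⟨x, hx⟩
  rw [hB, hB, ← h']
  exact A.mem_graph ⟨_, hx'⟩

variable [NormedAlternativeStarAlgebra 𝔸]

lemma star_real_smul_one : star (r • (1 : 𝔸)) = r • (1 : 𝔸) := by
  rw [star_smul, star_one, star_trivial]

lemma norm_real_smul_one_sq : ‖r • (1 : 𝔸)‖ ^ 2 = r ^ 2 := by
  rw [NormedAlternativeStarAlgebra.norm_eq_sqrt (r • (1 : 𝔸)) (Or.inl ⟨r, rfl⟩) (r ^ 2)
    (by rw [star_real_smul_one, smul_mul_smul_comm, mul_one, sq]),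
    Real.sq_sqrt (sq_nonneg r)]

/-- For real `r` the operator `Δ_r(A)` is `(A - r)²`. -/
lemma sphericalDelta_real (x : sqDomain A) {y z : X} (hy : ((x : X), y) ∈ A.graph)
    (hz : (y, z) ∈ A.graph) :
    sphericalDelta A (r • (1 : 𝔸)) x = (z - r • y) - r • (y - r • (x : X)) := by
  have h1 : A ⟨x, x.2.choose⟩ = y := A.mem_graph_snd_inj (A.mem_graph _) hy rfl
  have h2 : A ⟨A ⟨x, x.2.choose⟩, x.2.choose_spec⟩ = z :=
    A.mem_graph_snd_inj (A.mem_graph _) hz h1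
  have h3 : (2 : ℝ) • ((2 : ℝ)⁻¹ • (r • (1 : 𝔸) + star (r • (1 : 𝔸)))) = (2 * r) • (1 : 𝔸) := by
    rw [star_real_smul_one, ← add_smul, smul_smul, smul_smul]
    congr 1
    ring
  rw [sphericalDelta, h2, h1, h3, NormedAlternativeBimodule.left_real_smul, norm_real_smul_one_sq]
  module

lemma mem_sqDomain {x y z : X} (hy : (x, y) ∈ A.graph) (hz : (y, z) ∈ A.graph) :
    x ∈ sqDomain A := by
  obtain ⟨hx, rfl⟩ := LinearPMap.mem_graph_apply hy
  exact ⟨hx, (LinearPMap.mem_graph_apply hz).1⟩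

lemma exists_graph_of_mem_sqDomain (x : sqDomain A) :
    ∃ y z, ((x : X), y) ∈ A.graph ∧ (y, z) ∈ A.graph :=
  ⟨_, _, A.mem_graph ⟨x, x.2.choose⟩, A.mem_graph ⟨_, x.2.choose_spec⟩⟩

/-- If `(A - r)²` is a bijection of the domain of `A²` onto `X`, then `A - r` is a bijection of the
domain of `A` onto `X`: an eigenvector for `r` would lie in the domain of `A²`. -/
lemma exists_isRealResolvent_of_mem [CompleteSpace X] (hA : A.IsClosed)
    (h : r • (1 : 𝔸) ∈ sphericalResolventSet 𝔸 A) : ∃ R : X →L[ℝ] X, IsRealResolvent A r R := by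
  obtain ⟨-, ⟨hinj, hsurj⟩, -⟩ := h
  refine IsRealResolvent.exists_of_bijective hA (fun x hx => ?_) fun y => ?_
  · have hrx : (r • x, r • r • x) ∈ A.graph := A.graph.smul_mem r hx
    have h0 : ((0 : X), (0 : X)) ∈ A.graph := A.graph.zero_mem
    have heq : (⟨x, mem_sqDomain hx hrx⟩ : sqDomain A) = ⟨0, mem_sqDomain h0 h0⟩ := by
      apply hinj
      rw [sphericalDelta_real _ hx hrx, sphericalDelta_real _ h0 h0]
      simp
    exact congrArg Subtype.val heq
  · obtain ⟨x, hx⟩ := hsurj y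
    obtain ⟨w, z, hw, hz⟩ := exists_graph_of_mem_sqDomain x
    refine ⟨w - r • (x : X), ?_⟩
    rw [← hx, sphericalDelta_real x hw hz, sub_add_cancel]
    exact A.graph.sub_mem hz (A.graph.smul_mem r hw)

lemma IsRealResolvent.mem_sphericalResolventSet {R : X →L[ℝ] X} (hR : IsRealResolvent A r R)
    (hlin : IsRightLinear 𝔸 A) : r • (1 : 𝔸) ∈ sphericalResolventSet 𝔸 A := by
  have hleft : ∀ x : sqDomain A, R (R (sphericalDelta A (r • (1 : 𝔸)) x)) = x := fun x => by
    obtain ⟨y, z, hy, hz⟩ := exists_graph_of_mem_sqDomain x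
    rw [sphericalDelta_real x hy hz, hR.apply_sub _ _
      (show (y - r • (x : X), z - r • y) ∈ A.graph from
        A.graph.sub_mem hz (A.graph.smul_mem r hy)), hR.apply_sub _ _ hy]
  refine ⟨Or.inl ⟨r, rfl⟩, ⟨fun x y hxy => ?_, fun y => ?_⟩, R.comp R, ?_, hleft⟩
  · exact Subtype.ext (by rw [← hleft x, hxy, hleft y])
  · have h1 := hR.mem_graph (R y)
    have h2 : (R y + r • R (R y), (y + r • R y) + r • (R y + r • R (R y))) ∈ A.graph :=
      A.graph.add_mem (hR.mem_graph y) (A.graph.smul_mem r h1)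
    refine ⟨⟨R (R y), mem_sqDomain h1 h2⟩, ?_⟩
    rw [sphericalDelta_real _ h1 h2]
    module
  · intro α x
    obtain ⟨B, hB, hBA⟩ := hlin.exists_clm α
    simp only [ContinuousLinearMap.comp_apply, ← hB, hR.commute B hBA]

end Spherical

theorem theoremT {𝔸 X : Type*} [NonAssocRing 𝔸] [Module ℝ 𝔸] [StarRing 𝔸] [Norm 𝔸]
    [NormedAlternativeStarAlgebra 𝔸]
    [NormedAddCommGroup X] [NormedSpace ℝ X] [CompleteSpace X] [SMul 𝔸 X] [SMul 𝔸ᵐᵒᵖ X]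
    [NormedAlternativeBimodule 𝔸 X]
    (A : X →ₗ.[ℝ] X) (hlin : IsRightLinear 𝔸 A) (hclosed : A.IsClosed)
    (hdense : Dense (A.domain : Set X)) :
    ((∃ T : ℝ → X →L[ℝ] X, IsStronglyContinuousSemigroup 𝔸 T ∧ IsGenerator A T) ↔
      ((sphericalResolventSet 𝔸 A ∩ Set.range (fun r : ℝ => r • (1 : 𝔸))).Nonempty ∧
        ∀ x ∈ A.domain, ∃ u : ℝ → X, IsC1Solution A x u ∧
          ∀ v : ℝ → X, IsC1Solution A x v → Set.EqOn v u (Set.Ici 0))) ∧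
    (∀ T : ℝ → X →L[ℝ] X, IsStronglyContinuousSemigroup 𝔸 T → IsGenerator A T →
      ∀ x ∈ A.domain, IsC1Solution A x (fun t => T t x) ∧
        ∀ v : ℝ → X, IsC1Solution A x v → ∀ t, 0 ≤ t → v t = T t x) := by
  have hsol : ∀ T : ℝ → X →L[ℝ] X, IsStronglyContinuousSemigroup 𝔸 T → IsGenerator A T →
      ∀ x ∈ A.domain, IsC1Solution A x (fun t => T t x) ∧
        ∀ v : ℝ → X, IsC1Solution A x v → ∀ t, 0 ≤ t → v t = T t x := by
    intro T hT hA x hx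
    refine ⟨(hT.isGraphSolution hA (A.mem_graph ⟨x, hx⟩)).isC1Solution, fun v hv t ht => ?_⟩
    obtain ⟨w, hw⟩ := hv.exists_isGraphSolution
    exact hT.eq_of_isGraphSolution hA hw ht
  refine ⟨⟨?_, ?_⟩, hsol⟩
  · rintro ⟨T, hT, hA⟩
    obtain ⟨l, R, hR⟩ := hT.exists_isRealResolvent hA hclosed
    refine ⟨⟨_, hR.mem_sphericalResolventSet hlin, l, rfl⟩, fun x hx => ⟨fun t => T t x, ?_⟩⟩
    exact hsol T hT hA x hx
  · rintro ⟨⟨_, hρ, r, rfl⟩, hwp⟩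
    obtain ⟨R, hR⟩ := exists_isRealResolvent_of_mem hclosed hρ
    have hw : IsWellPosed A :=
      { exists_solution := fun x y hxy => by
          obtain ⟨u, hu, -⟩ := hwp x (LinearPMap.mem_graph_apply hxy).1
          exact ⟨u, hu.exists_isGraphSolution⟩
        unique := fun {x u v u' v'} h h' => by
          have hx : x ∈ A.domain := by
            rw [← h.initial]
            exact (LinearPMap.mem_graph_apply (h.mem_graph 0 le_rfl)).1
          obtain ⟨w, -, hw⟩ := hwp x hx
          exact (hw u h.isC1Solution).trans (hw u' h'.isC1Solution).symm }
    exact hw.exists_semigroup 𝔸 hclosed hR hlin.exists_clm
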